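/- Let $A$ be an associative ring with unit and let $\operatorname{Mod} A$ be the category of right $A$-modules. Assume that $A$ is (right) hereditary, i.e. $\operatorname{Ext}_A^n(M,N)=0$ for all right $A$-modules $M,N$ and all $n>1$. Let $\mathcal Y$ be an extension-closed abelian subcategory of $\operatorname{Mod} A$ that is closed under taking arbitrary (set-indexed) products and coproducts; here an abelian subcategory is a full subcategory, closed under isomorphisms, which is itself an abelian category and whose inclusion functor into $\operatorname{Mod} A$ is exact. For a class $\mathcal C$ of right $A$-modules write $${}^\perp\mathcal C=\{X\mid \operatorname{Ext}_A^n(X,C)=0\text{ for all }C\in\mathcal C,\ n\ge 0\},\qquad \mathcal C^\perp=\{Y\mid \operatorname{Ext}_A^n(C,Y)=0\text{ for all }C\in\mathcal C,\ n\ge 0\},$$ where $\operatorname{Ext}_A^0=\operatorname{Hom}_A$. A pair $(\mathcal U,\mathcal V)$ of full subcategories of $\operatorname{Mod} A$ is an Ext-orthogonal pair if $\mathcal U^\perp=\mathcal V$ and $\mathcal U={}^\perp\mathcal V$; it is complete if for every right $A$-module $M$ there is an exact sequence $$0\to V_M\to U_M\to M\to V^M\to U^M\to 0$$ with $U_M,U^M\in\mathcal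 U$ and $V_M,V^M\in\mathcal V$. Set $\mathcal X={}^\perp\mathcal Y$ and $\mathcal Z=\mathcal Y^\perp$. Then $(\mathcal X,\mathcal Y)$ and $(\mathcal Y,\mathcal Z)$ are both complete Ext-orthogonal pairs for $\operatorname{Mod} A$. -/

import Mathlib

open CategoryTheory

universe w v u

namespace ExtOrthogonal

variable {C : Type u} [Category.{v} C]

/-- A full subcategory, given by a property `P` of objects, is an *abelian subcategory* of the
abelian category `C` if it is closed under isomorphisms, is itself an abelian category, and its
inclusion functor into `C` is exact. -/
structure IsAbelianSubcategory [Abelian C] (P : ObjectProperty C) : Prop where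
  closedUnderIso : P.IsClosedUnderIsomorphisms
  abelian : Nonempty (Abelian P.FullSubcategory)
  exact_ι : exactFunctor P.FullSubcategory C P.ι

/-- `P` is closed under taking arbitrary (small) products in `C`. -/
def IsClosedUnderProducts (P : ObjectProperty C) : Prop :=
  ∀ J : Type v, P.IsClosedUnderLimitsOfShape (Discrete J)

/-- `P` is closed under taking arbitrary (small) coproducts in `C`. -/
def IsClosedUnderCoproducts (P : ObjectProperty C) : Prop :=
  ∀ J : Type v, P.IsClosedUnderColimitsOfShape (Discrete J)

variable [Abelian C]

variable (C) in
/-- An abelian category is hereditary if `Extⁿ(-,-)` vanishes for all `n > 1`. -/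
def IsHereditaryCategory [HasExt.{w} C] : Prop :=
  ∀ (n : ℕ), 1 < n → ∀ X Y : C, Subsingleton (Abelian.Ext.{w} X Y n)

/-- `Ext^*(X, Y) = 0`, that is, `Extⁿ(X, Y) = 0` in every degree; degree `0` is `Hom(X, Y)`,
and the groups in negative degrees are zero by convention. -/
def ExtVanishes [HasExt.{w} C] (X Y : C) : Prop :=
  ∀ n : ℕ, Subsingleton (Abelian.Ext.{w} X Y n)

/-- The left Ext-orthogonal subcategory `⊥P`. -/
def leftPerp [HasExt.{w} C] (P : ObjectProperty C) : ObjectProperty C :=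
  fun X => ∀ Y : C, P Y → ExtVanishes.{w} X Y

/-- The right Ext-orthogonal subcategory `P⊥`. -/
def rightPerp [HasExt.{w} C] (P : ObjectProperty C) : ObjectProperty C :=
  fun Y => ∀ X : C, P X → ExtVanishes.{w} X Y

/-- `M` admits an exact sequence `0 ⟶ Y₁ ⟶ X₁ ⟶ M ⟶ Y₂ ⟶ X₂ ⟶ 0` with `X₁, X₂` in `𝒳` and
`Y₁, Y₂` in `𝒴`. -/
def HasApproximationSequence (𝒳 𝒴 : ObjectProperty C) (M : C) : Prop :=
  ∃ (Y₁ X₁ Y₂ X₂ : C) (a : Y₁ ⟶ X₁) (b : X₁ ⟶ M) (c : M ⟶ Y₂) (d : Y₂ ⟶ X₂)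
    (hab : a ≫ b = 0) (hbc : b ≫ c = 0) (hcd : c ≫ d = 0),
    𝒴 Y₁ ∧ 𝒳 X₁ ∧ 𝒴 Y₂ ∧ 𝒳 X₂ ∧
    Mono a ∧ (ShortComplex.mk a b hab).Exact ∧ (ShortComplex.mk b c hbc).Exact ∧
    (ShortComplex.mk c d hcd).Exact ∧ Epi d

/-- `(𝒳, 𝒴)` is an Ext-orthogonal pair: `𝒳⊥ = 𝒴` and `𝒳 = ⊥𝒴`. -/
structure IsExtOrthogonalPair [HasExt.{w} C] (𝒳 𝒴 : ObjectProperty C) : Prop where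
  rightPerp_eq : rightPerp.{w} 𝒳 = 𝒴
  eq_leftPerp : 𝒳 = leftPerp.{w} 𝒴

/-- An Ext-orthogonal pair is complete if every object of `C` has a 5-term approximation
sequence. -/
structure IsCompleteExtOrthogonalPair [HasExt.{w} C] (𝒳 𝒴 : ObjectProperty C) : Prop extends
    IsExtOrthogonalPair.{w} 𝒳 𝒴 where
  exists_sequence : ∀ M : C, HasApproximationSequence 𝒳 𝒴 M

/-- The category `Mod A` of right `A`-modules. -/
abbrev RightMod (A : Type u) [Ring A] := ModuleCat.{u} Aᵐᵒᵖ

/-- A ring is (right) hereditary if its category of right modules is hereditary. -/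
def IsHereditaryRing (A : Type u) [Ring A] : Prop :=
  IsHereditaryCategory.{u} (RightMod A)

end ExtOrthogonal

namespace ExtOrthogonal

/-! ### Reflections, coreflections and first Ext groups -/

section

open Limits Abelian

variable {C : Type u} [Category.{v} C] [Abelian C]

/-! Closure under kernels, cokernels, products and coproducts makes 𝒴 reflective and coreflective in
the module category. For reflections (`exists_isReflection`) this is a solution-set argument: if f :
M → Y does not factor through a smaller subobject of Y in 𝒴, then the size of Y is bounded in terms
of M, by a compactness argument with reduced products (`IsRelEpi.exists_finite_witness`).
Coreflections (`exists_isCoreflection`) are built from a generator.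

Let η : M → L be the reflection. Extension closure makes Ext¹(L, Y) → Ext¹(M, Y) injective for Y in
𝒴. Together with Ext² = 0 this puts coker η in ⊥𝒴 and gives Hom(ker η, 𝒴) = 0. The kernel may still
have Ext¹ into 𝒴, but on 𝒴 the functor Ext¹(ker η, -) is represented by an object of 𝒴, and the
middle term of the universal extension lies in ⊥𝒴 (`exists_shortExact_leftPerp`). Splicing gives the
five-term sequence, which in turn forces (⊥𝒴)⊥ = 𝒴. The pair (𝒴, 𝒴⊥) is treated dually, with
coreflections and injectives. -/

lemma shortExact_kernel {X Y : C} (p : X ⟶ Y) [Epi p] :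
    (ShortComplex.mk (kernel.ι p) p (kernel.condition p)).ShortExact where
  exact := ShortComplex.exact_kernel p

lemma shortExact_cokernel {X Y : C} (i : X ⟶ Y) [Mono i] :
    (ShortComplex.mk i (cokernel.π i) (cokernel.condition i)).ShortExact where
  exact := ShortComplex.exact_cokernel i

lemma shortExact_image_cokernel {X Y : C} (f : X ⟶ Y) :
    (ShortComplex.mk (Abelian.image.ι f) (cokernel.π f) (kernel.condition _)).ShortExact where
  exact := ShortComplex.exact_kernel _
  mono_f := inferInstanceAs (Mono (Abelian.image.ι f))
  epi_g := inferInstanceAs (Epi (cokernel.π f))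

lemma shortExact_kernel_image {X Y : C} (f : X ⟶ Y) :
    (ShortComplex.mk (kernel.ι f) (Abelian.factorThruImage f)
      (by rw [← cancel_mono (Abelian.image.ι f)]; simp)).ShortExact where
  exact := ShortComplex.exact_of_f_is_kernel _ (KernelFork.IsLimit.ofι _ _
    (fun k hk => kernel.lift f k (by
      dsimp at hk
      rw [← Abelian.image.fac f, ← Category.assoc, hk, zero_comp]))
    (fun k hk => by simp)
    (fun k hk m hm => by rw [← cancel_mono (kernel.ι f), kernel.lift_ι]; exact hm))
  mono_f := inferInstanceAs (Mono (kernel.ι f))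
  epi_g := inferInstanceAs (Epi (Abelian.factorThruImage f))

lemma shortExact_pushout {S : ShortComplex C} (hS : S.ShortExact) {Y : C} (h : S.X₁ ⟶ Y) :
    (ShortComplex.mk (pushout.inr S.f h) (pushout.desc S.g 0 (by simp))
      (pushout.inr_desc _ _ _)).ShortExact := by
  have := hS.mono_f
  have := hS.epi_g
  have : Epi (pushout.desc S.g (0 : Y ⟶ _) (by simp) : pushout S.f h ⟶ S.X₃) :=
    epi_of_epi_fac (pushout.inl_desc (f := S.f) (g := h) S.g 0 (by simp))
  refine ShortComplex.ShortExact.mk' (ShortComplex.exact_of_g_is_cokernel _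
    (CokernelCofork.IsColimit.ofπ _ _ (fun {T} k hk => hS.exact.desc (pushout.inl S.f h ≫ k)
      (by dsimp at hk; rw [pushout.condition_assoc, hk, comp_zero])) ?_ ?_))
    (inferInstanceAs (Mono (pushout.inr S.f h))) this
  · intro T k hk
    apply pushout.hom_ext
    · exact (pushout.inl_desc_assoc _ _ _ _).trans (hS.exact.g_desc _ _)
    · exact (pushout.inr_desc_assoc _ _ _ _).trans (zero_comp.trans hk.symm)
  · intro T k hk m hm
    rw [← cancel_epi S.g, hS.exact.g_desc, ← hm, pushout.inl_desc_assoc]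

variable [HasExt.{w} C]

lemma extClass_pushout {S : ShortComplex C} (hS : S.ShortExact) {Y : C} (h : S.X₁ ⟶ Y) :
    hS.extClass.comp (Ext.mk₀.{w} h) (add_zero 1) = (shortExact_pushout hS h).extClass := by
  have := ShortComplex.ShortExact.extClass_naturality.{w} hS (shortExact_pushout hS h)
    { τ₁ := h, τ₂ := pushout.inl _ _, τ₃ := 𝟙 _, comm₁₂ := pushout.condition.symm
      comm₂₃ := (pushout.inl_desc _ _ _).trans (Category.comp_id _).symm }
  rwa [Ext.mk₀_id_comp] at this

/-- Every class in `Ext¹` is the class of a short exact sequence. -/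
lemma exists_extClass_eq [EnoughProjectives C] {X Y : C} (e : Ext.{w} X Y 1) :
    ∃ (E : C) (i : Y ⟶ E) (p : E ⟶ X) (z : i ≫ p = 0)
      (hS : (ShortComplex.mk i p z).ShortExact), hS.extClass = e := by
  have hS := shortExact_kernel (Projective.π X)
  -- The class dies on a projective cover of `X`, so it comes from a map on the syzygy; pushing out
  -- along that map realizes it.
  obtain ⟨h, hh⟩ := Ext.contravariant_sequence_exact₃ hS Y e (Ext.eq_zero_of_projective _)
    (n₀ := 0) rfl
  obtain ⟨h, rfl⟩ := Ext.addEquiv₀.symm.surjective h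
  exact ⟨_, _, _, _, shortExact_pushout hS h, (extClass_pushout hS h).symm.trans hh⟩

/-- `η : M ⟶ L` is a reflection of `M` into the subcategory `P`. -/
structure IsReflection (P : ObjectProperty C) {M L : C} (η : M ⟶ L) : Prop where
  prop : P L
  exists_fac : ∀ Y, P Y → ∀ f : M ⟶ Y, ∃ g, η ≫ g = f
  eq_zero : ∀ Y, P Y → ∀ g : L ⟶ Y, η ≫ g = 0 → g = 0

/-- `ε : R ⟶ M` is a coreflection of `M` into the subcategory `P`. -/
structure IsCoreflection (P : ObjectProperty C) {R M : C} (ε : R ⟶ M) : Prop where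
  prop : P R
  exists_fac : ∀ Y, P Y → ∀ f : Y ⟶ M, ∃ g, g ≫ ε = f
  eq_zero : ∀ Y, P Y → ∀ g : Y ⟶ R, g ≫ ε = 0 → g = 0

lemma hom_eq_zero_of_extVanishes {X Y : C} (h : ExtVanishes.{w} X Y) (f : X ⟶ Y) : f = 0 :=
  (Ext.mk₀_eq_zero_iff f).1 ((h 0).elim _ _)

lemma extVanishes_of_isHereditary (hC : IsHereditaryCategory.{w} C) {X Y : C}
    (h₀ : ∀ f : X ⟶ Y, f = 0) (h₁ : ∀ e : Ext.{w} X Y 1, e = 0) : ExtVanishes.{w} X Y := by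
  intro n
  match n with
  | 0 =>
    refine ⟨fun a b => Ext.addEquiv₀.injective ?_⟩
    rw [h₀ (Ext.addEquiv₀ a), h₀ (Ext.addEquiv₀ b)]
  | 1 => exact ⟨fun a b => by rw [h₁ a, h₁ b]⟩
  | n + 2 => exact hC _ (by omega) _ _

lemma ext_eq_zero_of_retract_left {X X' Y : C} (r : Retract X X') {n : ℕ}
    (h : ∀ e : Ext.{w} X' Y n, e = 0) (e : Ext.{w} X Y n) : e = 0 := by
  have := h ((Ext.mk₀ r.r).comp e (zero_add n))
  have h2 := congrArg (fun x => (Ext.mk₀ r.i).comp x (zero_add n)) this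
  simpa [Ext.mk₀_comp_mk₀_assoc] using h2

lemma ext_eq_zero_of_retract_right {X Y Y' : C} (r : Retract Y Y') {n : ℕ}
    (h : ∀ e : Ext.{w} X Y' n, e = 0) (e : Ext.{w} X Y n) : e = 0 := by
  have := h (e.comp (Ext.mk₀ r.i) (add_zero n))
  have h2 := congrArg (fun x => x.comp (Ext.mk₀ r.r) (add_zero n)) this
  simpa [Ext.comp_assoc_of_third_deg_zero] using h2

variable {P : ObjectProperty C}

namespace IsReflection

/-- If `e` is the class of Y → E → L, then E lies in `P`. A lift of η to E factors through η, and by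
uniqueness the factor L → E is a section. -/
lemma ext_eq_zero [EnoughProjectives C] [P.IsClosedUnderExtensions] {M L : C} {η : M ⟶ L}
    (hη : IsReflection P η) {Y : C} (hY : P Y) (e : Ext.{w} L Y 1)
    (he : (Ext.mk₀ η).comp e (zero_add 1) = 0) : e = 0 := by
  obtain ⟨E, i, p, z, hS, rfl⟩ := exists_extClass_eq e
  obtain ⟨t, ht⟩ := Ext.covariant_sequence_exact₃ _ hS _ rfl he
  obtain ⟨t, rfl⟩ := Ext.addEquiv₀.symm.surjective t
  change (Ext.mk₀ t).comp (Ext.mk₀ p) (add_zero 0) = _ at ht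
  rw [Ext.mk₀_comp_mk₀] at ht
  have ht := Ext.mk₀_bijective _ _ |>.1 ht
  obtain ⟨g, rfl⟩ := hη.exists_fac E (P.prop_X₂_of_shortExact hS hY hη.prop) t
  have hg : g ≫ p = 𝟙 L := by
    rw [← sub_eq_zero]
    exact hη.eq_zero _ hη.prop _ (by simp only [Preadditive.comp_sub, ← Category.assoc, ht]; simp)
  rw [← Ext.mk₀_id_comp hS.extClass, ← hg, ← Ext.mk₀_comp_mk₀_assoc]
  erw [hS.comp_extClass]
  simp

/-- A class on the cokernel dies on L, since it dies on M; so it comes from a map im η → Y. That map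
extends to L by the reflection property, so its connecting image is zero. -/
lemma leftPerp_cokernel [EnoughProjectives C] [P.IsClosedUnderExtensions]
    (hC : IsHereditaryCategory.{w} C) {M L : C} {η : M ⟶ L} (hη : IsReflection P η) :
    leftPerp.{w} P (cokernel η) := by
  intro Y hY
  refine extVanishes_of_isHereditary hC (fun f => ?_) (fun e => ?_)
  · rw [← cancel_epi (cokernel.π η), comp_zero]
    exact hη.eq_zero _ hY _ (by simp)
  · have h₁ : (Ext.mk₀ (cokernel.π η)).comp e (zero_add 1) = 0 :=
      hη.ext_eq_zero hY _ (by simp [Ext.mk₀_comp_mk₀_assoc])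
    have hS := shortExact_image_cokernel η
    obtain ⟨h, rfl⟩ := Ext.contravariant_sequence_exact₃ hS Y e h₁ (n₀ := 0) rfl
    obtain ⟨h, rfl⟩ := Ext.addEquiv₀.symm.surjective h
    obtain ⟨g, hg⟩ := hη.exists_fac Y hY (Abelian.factorThruImage η ≫ h)
    have : h = Abelian.image.ι η ≫ g := by
      rw [← cancel_epi (Abelian.factorThruImage η), ← hg, ← Category.assoc, Abelian.image.fac]
    subst this
    change hS.extClass.comp (Ext.mk₀ _) _ = 0
    rw [← Ext.mk₀_comp_mk₀]
    exact hS.extClass_comp_assoc _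

/-- Pushing ker η → M → im η out along `h` gives a class in Ext¹(im η, Y), which extends to L
because Ext²(coker η, Y) = 0. The extended class dies on M, hence is zero, so `h` extends to M; the
extension factors through η and therefore kills ker η. -/
lemma kernel_hom_eq_zero [EnoughProjectives C] [P.IsClosedUnderExtensions]
    (hC : IsHereditaryCategory.{w} C) {M L : C} {η : M ⟶ L} (hη : IsReflection P η)
    {Y : C} (hY : P Y) (h : kernel η ⟶ Y) : h = 0 := by
  have hS := shortExact_image_cokernel η
  have hT := shortExact_kernel_image η
  obtain ⟨e, he⟩ := Ext.contravariant_sequence_exact₁ hS Y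
    (hT.extClass.comp (Ext.mk₀ h) (add_zero 1)) (n₁ := 2) rfl
    ((hC 2 (by omega) _ _).elim _ _)
  have he0 : e = 0 := by
    refine hη.ext_eq_zero hY e ?_
    have : Ext.mk₀ η = Ext.mk₀.{w} (Abelian.factorThruImage η ≫ Abelian.image.ι η) := by
      rw [Abelian.image.fac]
    rw [this, ← Ext.mk₀_comp_mk₀_assoc]
    erw [he]
    exact hT.comp_extClass_assoc _ _
  subst he0
  rw [Ext.comp_zero] at he
  obtain ⟨g, hg⟩ := Ext.contravariant_sequence_exact₁ hT Y (Ext.mk₀ h) rfl he.symm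
  obtain ⟨g, rfl⟩ := Ext.addEquiv₀.symm.surjective g
  obtain ⟨g, rfl⟩ := hη.exists_fac Y hY g
  change (Ext.mk₀ (kernel.ι η)).comp (Ext.mk₀ (η ≫ g)) _ = _ at hg
  rw [Ext.mk₀_comp_mk₀, kernel.condition_assoc, zero_comp, Ext.mk₀_zero] at hg
  exact (Ext.mk₀_eq_zero_iff h).1 hg.symm

end IsReflection

end

/-! ### Universal extensions and the pair (⊥P, P) -/

section

open Limits Abelian

variable {C : Type u} [Category.{v} C] [Abelian C] [HasExt.{w} C] {P : ObjectProperty C}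

lemma exists_section_of_extClass_eq_zero {S : ShortComplex C} (hS : S.ShortExact)
    (h : hS.extClass = (0 : Ext.{w} _ _ 1)) : ∃ σ : S.X₃ ⟶ S.X₂, σ ≫ S.g = 𝟙 _ := by
  obtain ⟨σ, hσ⟩ := Ext.covariant_sequence_exact₃ _ hS (Ext.mk₀.{w} (𝟙 _)) rfl
    (by rw [h, Ext.comp_zero])
  obtain ⟨σ, rfl⟩ := Ext.addEquiv₀.symm.surjective σ
  change (Ext.mk₀ σ).comp _ _ = _ at hσ
  rw [Ext.mk₀_comp_mk₀] at hσ
  exact ⟨σ, (Ext.mk₀_bijective _ _).1 hσ⟩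

lemma ext_kernel_eq_zero (hC : IsHereditaryCategory.{w} C) {X Q Y : C} [Projective Q]
    (p : Q ⟶ X) [Epi p] (e : Ext.{w} (kernel p) Y 1) : e = 0 := by
  obtain ⟨x, rfl⟩ := Ext.contravariant_sequence_exact₁ (shortExact_kernel p) Y e (n₁ := 2) rfl
    ((hC 2 (by omega) _ _).elim _ _)
  rw [Ext.eq_zero_of_projective x, Ext.comp_zero]

/-- An object without nonzero morphisms to `P` has a universal extension by an object of `P`,
and the middle term of this extension is left Ext-orthogonal to `P`. -/
lemma exists_shortExact_leftPerp [EnoughProjectives C] [P.IsClosedUnderExtensions]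
    [P.IsClosedUnderKernels] [P.IsClosedUnderCokernels] (hC : IsHereditaryCategory.{w} C)
    (hR : ∀ M : C, ∃ (L : C) (η : M ⟶ L), IsReflection P η) {K : C}
    (hK : ∀ Y, P Y → ∀ f : K ⟶ Y, f = 0) :
    ∃ (Y X : C) (a : Y ⟶ X) (b : X ⟶ K) (z : a ≫ b = 0),
      P Y ∧ leftPerp.{w} P X ∧ (ShortComplex.mk a b z).ShortExact := by
  let p := Projective.π K
  let i := kernel.ι p
  have hS : (ShortComplex.mk i p (kernel.condition p)).ShortExact := shortExact_kernel p
  obtain ⟨L₀, η₀, hη₀⟩ := hR (Projective.over K)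
  obtain ⟨L₁, η₁, hη₁⟩ := hR (kernel p)
  have hL₀ : ∀ Y, P Y → ∀ e : Ext.{w} L₀ Y 1, e = 0 := fun Y hY e =>
    hη₀.ext_eq_zero hY e (Ext.eq_zero_of_projective _)
  have hL₁ : ∀ Y, P Y → ∀ e : Ext.{w} L₁ Y 1, e = 0 := fun Y hY e =>
    hη₁.ext_eq_zero hY e (ext_kernel_eq_zero hC _ _)
  obtain ⟨φ, hφ⟩ := hη₁.exists_fac _ hη₀.prop (i ≫ η₀)
  -- The composite of `η₀` with L₀ → coker φ kills the syzygy, so it descends to a map from `K` to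
  -- an object of `P`, which is zero.
  have : Epi φ := by
    refine Preadditive.epi_of_cokernel_zero
      (hη₀.eq_zero _ (P.prop_cokernel φ hη₁.prop hη₀.prop) _ ?_)
    have h : i ≫ η₀ ≫ cokernel.π φ = 0 := by
      rw [← Category.assoc, ← hφ, Category.assoc, cokernel.condition, comp_zero]
    have h' : p ≫ hS.exact.desc _ h = η₀ ≫ cokernel.π φ := hS.exact.g_desc _ h
    rw [← h', hK _ (P.prop_cokernel φ hη₁.prop hη₀.prop) (hS.exact.desc _ h), comp_zero]
  have hY : P (kernel φ) := P.prop_kernel φ hη₁.prop hη₀.prop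
  -- Hence L₁ = ker φ ⊕ L₀, with projection `r` onto ker φ. The object ker φ represents Ext¹(K, -)
  -- on `P`, and pushing out along `η₁ ≫ r` gives the universal extension.
  obtain ⟨σ, hσ⟩ : ∃ σ : L₀ ⟶ L₁, σ ≫ φ = 𝟙 _ :=
    exists_section_of_extClass_eq_zero.{w} (shortExact_kernel φ) (hL₀ _ hY _)
  obtain ⟨r, hr⟩ : ∃ r, r ≫ kernel.ι φ = 𝟙 L₁ - φ ≫ σ :=
    ⟨kernel.lift φ (𝟙 L₁ - φ ≫ σ) (by simp [hσ]), kernel.lift_ι _ _ _⟩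
  have hkr : kernel.ι φ ≫ r = 𝟙 _ := by
    rw [← cancel_mono (kernel.ι φ)]; simp [hr]
  have hσr : σ ≫ r = 0 := by
    rw [← cancel_mono (kernel.ι φ)]; simp [hr, reassoc_of% hσ]
  refine ⟨_, _, _, _, _, hY, ?_, shortExact_pushout hS (η₁ ≫ r)⟩
  intro Y hPY
  refine extVanishes_of_isHereditary hC (fun f => ?_) (fun e => ?_)
  · obtain ⟨u, hu⟩ := hη₀.exists_fac Y hPY (pushout.inl _ _ ≫ f)
    have h := hη₁.eq_zero Y hPY (φ ≫ u - r ≫ pushout.inr _ _ ≫ f) (by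
      rw [Preadditive.comp_sub, ← Category.assoc, hφ, Category.assoc, hu, sub_eq_zero]
      exact (pushout.condition_assoc (f := i) (g := η₁ ≫ r) f).trans (Category.assoc _ _ _))
    rw [sub_eq_zero] at h
    have hv : pushout.inr i (η₁ ≫ r) ≫ f = 0 := by
      have := congrArg (fun x => kernel.ι φ ≫ x) h
      simpa [reassoc_of% hkr] using this.symm
    have hu0 : u = 0 := by
      have := congrArg (fun x => σ ≫ x) h
      simpa [reassoc_of% hσ, reassoc_of% hσr] using this
    refine pushout.hom_ext ?_ ?_
    · rw [comp_zero]; exact hu.symm.trans (by rw [hu0, comp_zero])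
    · rw [comp_zero]; exact hv
  · have hU := shortExact_pushout hS (η₁ ≫ r)
    obtain ⟨e, rfl⟩ := Ext.contravariant_sequence_exact₂ hU Y e
      (ext_eq_zero_of_retract_left ⟨kernel.ι φ, r, hkr⟩ (hL₁ Y hPY) _)
    obtain ⟨h, rfl⟩ := Ext.contravariant_sequence_exact₃ hS Y e (Ext.eq_zero_of_projective _)
      (n₀ := 0) rfl
    obtain ⟨h, rfl⟩ := Ext.addEquiv₀.symm.surjective h
    obtain ⟨g, rfl⟩ := hη₁.exists_fac Y hPY h
    -- The splitting of L₁ separates a part extending to the projective cover, killed by the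
    -- connecting map, from a part whose class is pushed out from the universal extension and so
    -- dies on its middle term.
    have hg : η₁ ≫ g = i ≫ (η₀ ≫ σ ≫ g) + (η₁ ≫ r) ≫ (kernel.ι φ ≫ g) := by
      have : (r ≫ kernel.ι φ + φ ≫ σ) ≫ g = g := by rw [hr]; simp
      conv_lhs => rw [← this]
      simp only [Preadditive.add_comp, Preadditive.comp_add, Category.assoc, reassoc_of% hφ]
      rw [add_comm]
    change (Ext.mk₀ _).comp (hS.extClass.comp (Ext.mk₀ (η₁ ≫ g)) _) _ = 0
    rw [hg, Ext.mk₀_add, Ext.comp_add]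
    have h₁ : hS.extClass.comp (Ext.mk₀ (i ≫ (η₀ ≫ σ ≫ g))) (add_zero 1) = 0 := by
      rw [← Ext.mk₀_comp_mk₀]
      exact hS.extClass_comp_assoc _
    have h₂ : hS.extClass.comp (Ext.mk₀ ((η₁ ≫ r) ≫ (kernel.ι φ ≫ g))) (add_zero 1) =
        hU.extClass.comp (Ext.mk₀ (kernel.ι φ ≫ g)) (add_zero 1) := by
      rw [← extClass_pushout hS (η₁ ≫ r), ← Ext.mk₀_comp_mk₀,
        Ext.comp_assoc_of_third_deg_zero]
    rw [h₁, zero_add, h₂]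
    exact hU.comp_extClass_assoc _ _

/-- Splices the universal extension of ker η with ker η → M → L → coker η. -/
lemma hasApproximationSequence_leftPerp [EnoughProjectives C] [P.IsClosedUnderExtensions]
    [P.IsClosedUnderKernels] [P.IsClosedUnderCokernels] (hC : IsHereditaryCategory.{w} C)
    (hR : ∀ M : C, ∃ (L : C) (η : M ⟶ L), IsReflection P η) (M : C) :
    HasApproximationSequence (leftPerp.{w} P) P M := by
  obtain ⟨L, η, hη⟩ := hR M
  obtain ⟨Y, X, a, b, z, hY, hX, hS⟩ :=
    exists_shortExact_leftPerp hC hR (fun _ hY f => hη.kernel_hom_eq_zero hC hY f)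
  have := hS.mono_f
  have := hS.epi_g
  dsimp at this
  refine ⟨Y, X, L, cokernel η, a, b ≫ kernel.ι η, η, cokernel.π η, by rw [reassoc_of% z, zero_comp],
    by simp, cokernel.condition η, hY, hX, hη.prop, hη.leftPerp_cokernel hC, hS.mono_f, ?_, ?_,
    ShortComplex.exact_cokernel η, inferInstance⟩
  · exact (ShortComplex.exact_iff_of_epi_of_isIso_of_mono
      (S₁ := ShortComplex.mk a b z) (S₂ := ShortComplex.mk a (b ≫ kernel.ι η) _)
      { τ₁ := 𝟙 _, τ₂ := 𝟙 _, τ₃ := kernel.ι η }).1 hS.exact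
  · exact (ShortComplex.exact_iff_of_epi_of_isIso_of_mono
      (S₁ := ShortComplex.mk (b ≫ kernel.ι η) η _) (S₂ := ShortComplex.mk (kernel.ι η) η _)
      { τ₁ := b, τ₂ := 𝟙 _, τ₃ := 𝟙 _ }).2 (ShortComplex.exact_kernel η)

/-- If every object has an approximation sequence, then `P` is the right orthogonal of `⊥P`. -/
lemma isCompleteExtOrthogonalPair_leftPerp [P.IsClosedUnderIsomorphisms]
    (h : ∀ M : C, HasApproximationSequence (leftPerp.{w} P) P M) :
    IsCompleteExtOrthogonalPair.{w} (leftPerp.{w} P) P where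
  rightPerp_eq := by
    ext N
    refine ⟨fun hN => ?_, fun hN X hX => hX N hN⟩
    obtain ⟨Y₁, X₁, Y₂, X₂, a, b, c, d, hab, hbc, hcd, hY₁, hX₁, hY₂, hX₂, ha, e₁, e₂, e₃, hd⟩ :=
      h N
    -- The sequence becomes 0 → N → Y₂ → X₂ → 0, which splits; the section X₂ → Y₂ is zero, so X₂ =
    -- 0 and N ≅ Y₂.
    have hb : b = 0 := hom_eq_zero_of_extVanishes (hN _ hX₁) b
    have : Mono c := e₂.mono_g hb
    have hS : (ShortComplex.mk c d hcd).ShortExact := { exact := e₃ }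
    obtain ⟨s, hs⟩ := exists_section_of_extClass_eq_zero.{w} hS ((hN _ hX₂ 1).elim _ _)
    have hs0 : s = 0 := hom_eq_zero_of_extVanishes (hX₂ _ hY₂) s
    have hd0 : d = 0 := by
      rw [← Category.comp_id d]
      change d ≫ 𝟙 X₂ = 0
      rw [← hs, hs0, zero_comp, comp_zero]
    have : Epi c := e₃.epi_f hd0
    have : IsIso c := isIso_of_mono_of_epi c
    exact P.prop_of_iso (asIso c).symm hY₂
  eq_leftPerp := rfl
  exists_sequence := h

end

/-! ### The dual argument and the pair (P, P⊥) -/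

section

open Limits Abelian

variable {C : Type u} [Category.{v} C] [Abelian C]

lemma shortExact_pullback {S : ShortComplex C} (hS : S.ShortExact) {X : C} (h : X ⟶ S.X₃) :
    (ShortComplex.mk (pullback.lift S.f 0 (by simp)) (pullback.snd S.g h)
      (pullback.lift_snd _ _ _)).ShortExact := by
  have := hS.mono_f
  have := hS.epi_g
  have : Mono (pullback.lift S.f (0 : _ ⟶ X) (by simp) : S.X₁ ⟶ pullback S.g h) :=
    mono_of_mono_fac (pullback.lift_fst (f := S.g) (g := h) S.f 0 (by simp))
  refine ShortComplex.ShortExact.mk' (ShortComplex.exact_of_f_is_kernel _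
    (KernelFork.IsLimit.ofι _ _ (fun {T} k hk => hS.exact.lift (k ≫ pullback.fst S.g h)
      (by dsimp at hk; rw [Category.assoc, pullback.condition, reassoc_of% hk, zero_comp])) ?_ ?_))
    this (inferInstanceAs (Epi (pullback.snd S.g h)))
  · intro T k hk
    apply pullback.hom_ext
    · refine (Category.assoc _ _ _).trans ?_
      refine (congrArg (fun x => _ ≫ x) (pullback.lift_fst _ _ _)).trans (hS.exact.lift_f _ _)
    · refine (Category.assoc _ _ _).trans ?_
      refine (congrArg (fun x => _ ≫ x) (pullback.lift_snd _ _ _)).trans (comp_zero.trans hk.symm)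
  · intro T k hk m hm
    rw [← cancel_mono S.f, hS.exact.lift_f, ← hm, Category.assoc, pullback.lift_fst]

variable [HasExt.{w} C]

lemma extClass_pullback {S : ShortComplex C} (hS : S.ShortExact) {X : C} (h : X ⟶ S.X₃) :
    (Ext.mk₀.{w} h).comp hS.extClass (zero_add 1) = (shortExact_pullback hS h).extClass := by
  have := ShortComplex.ShortExact.extClass_naturality.{w} (shortExact_pullback hS h) hS
    { τ₁ := 𝟙 _, τ₂ := pullback.fst _ _, τ₃ := h
      comm₁₂ := (Category.id_comp _).trans (pullback.lift_fst _ _ _).symm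
      comm₂₃ := pullback.condition }
  rw [Ext.comp_mk₀_id] at this
  exact this.symm

variable {P : ObjectProperty C}

namespace IsCoreflection

lemma ext_eq_zero [EnoughProjectives C] [P.IsClosedUnderExtensions] {R M : C} {ε : R ⟶ M}
    (hε : IsCoreflection P ε) {Y : C} (hY : P Y) (e : Ext.{w} Y R 1)
    (he : e.comp (Ext.mk₀ ε) (add_zero 1) = 0) : e = 0 := by
  obtain ⟨E, i, p, z, hS, rfl⟩ := exists_extClass_eq e
  obtain ⟨t, ht⟩ := Ext.contravariant_sequence_exact₁ hS _ (Ext.mk₀ ε) rfl he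
  obtain ⟨t, rfl⟩ := Ext.addEquiv₀.symm.surjective t
  change (Ext.mk₀ i).comp (Ext.mk₀ t) (add_zero 0) = _ at ht
  rw [Ext.mk₀_comp_mk₀] at ht
  have ht := Ext.mk₀_bijective _ _ |>.1 ht
  obtain ⟨g, rfl⟩ := hε.exists_fac E (P.prop_X₂_of_shortExact hS hε.prop hY) t
  have hg : i ≫ g = 𝟙 R := by
    rw [← sub_eq_zero]
    exact hε.eq_zero _ hε.prop _ (by simp only [Preadditive.sub_comp, Category.assoc, ht]; simp)
  rw [← Ext.comp_mk₀_id hS.extClass, ← hg, ← Ext.mk₀_comp_mk₀]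
  exact hS.extClass_comp_assoc _

lemma rightPerp_kernel [EnoughProjectives C] [P.IsClosedUnderExtensions]
    (hC : IsHereditaryCategory.{w} C) {R M : C} {ε : R ⟶ M} (hε : IsCoreflection P ε) :
    rightPerp.{w} P (kernel ε) := by
  intro Y hY
  refine extVanishes_of_isHereditary hC (fun f => ?_) (fun e => ?_)
  · rw [← cancel_mono (kernel.ι ε), zero_comp]
    exact hε.eq_zero _ hY _ (by simp)
  · have h₁ : e.comp (Ext.mk₀ (kernel.ι ε)) (add_zero 1) = 0 :=
      hε.ext_eq_zero hY _ (by simp)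
    have hS := shortExact_kernel_image ε
    obtain ⟨h, rfl⟩ := Ext.covariant_sequence_exact₁ Y hS e h₁ (n₀ := 0) rfl
    obtain ⟨h, rfl⟩ := Ext.addEquiv₀.symm.surjective h
    obtain ⟨g, hg⟩ := hε.exists_fac Y hY (h ≫ Abelian.image.ι ε)
    have : h = g ≫ Abelian.factorThruImage ε := by
      rw [← cancel_mono (Abelian.image.ι ε), ← hg, Category.assoc, Abelian.image.fac]
    subst this
    change (Ext.mk₀ _).comp hS.extClass _ = 0
    rw [← Ext.mk₀_comp_mk₀, Ext.comp_assoc_of_second_deg_zero]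
    erw [hS.comp_extClass]
    rw [Ext.comp_zero]

lemma cokernel_hom_eq_zero [EnoughProjectives C] [P.IsClosedUnderExtensions]
    (hC : IsHereditaryCategory.{w} C) {R M : C} {ε : R ⟶ M} (hε : IsCoreflection P ε)
    {Y : C} (hY : P Y) (h : Y ⟶ cokernel ε) : h = 0 := by
  have hS := shortExact_kernel_image ε
  have hT := shortExact_image_cokernel ε
  obtain ⟨e, he⟩ := Ext.covariant_sequence_exact₃ Y hS
    ((Ext.mk₀ h).comp hT.extClass (zero_add 1)) (n₁ := 2) rfl
    ((hC 2 (by omega) _ _).elim _ _)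
  have he0 : e = 0 := by
    refine hε.ext_eq_zero hY e ?_
    have : Ext.mk₀ ε = Ext.mk₀.{w} (Abelian.factorThruImage ε ≫ Abelian.image.ι ε) := by
      rw [Abelian.image.fac]
    rw [this, ← Ext.mk₀_comp_mk₀, ← Ext.comp_assoc_of_third_deg_zero]
    erw [he]
    rw [Ext.comp_assoc_of_third_deg_zero]
    erw [hT.extClass_comp]
    rw [Ext.comp_zero]
  subst he0
  rw [Ext.zero_comp] at he
  obtain ⟨g, hg⟩ := Ext.covariant_sequence_exact₃ Y hT (Ext.mk₀ h) rfl he.symm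
  obtain ⟨g, rfl⟩ := Ext.addEquiv₀.symm.surjective g
  obtain ⟨g, rfl⟩ := hε.exists_fac Y hY g
  change (Ext.mk₀ (g ≫ ε)).comp (Ext.mk₀ (cokernel.π ε)) _ = _ at hg
  rw [Ext.mk₀_comp_mk₀, Category.assoc, cokernel.condition, comp_zero, Ext.mk₀_zero] at hg
  exact (Ext.mk₀_eq_zero_iff h).1 hg.symm

end IsCoreflection

lemma exists_retraction_of_extClass_eq_zero {S : ShortComplex C} (hS : S.ShortExact)
    (h : hS.extClass = (0 : Ext.{w} _ _ 1)) : ∃ r : S.X₂ ⟶ S.X₁, S.f ≫ r = 𝟙 _ := by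
  obtain ⟨σ, hσ⟩ := Ext.contravariant_sequence_exact₁ hS _ (Ext.mk₀.{w} (𝟙 _)) rfl
    (by rw [h, Ext.zero_comp])
  obtain ⟨σ, rfl⟩ := Ext.addEquiv₀.symm.surjective σ
  change (Ext.mk₀ _).comp (Ext.mk₀ σ) _ = _ at hσ
  rw [Ext.mk₀_comp_mk₀] at hσ
  exact ⟨σ, (Ext.mk₀_bijective _ _).1 hσ⟩

lemma ext_cokernel_eq_zero (hC : IsHereditaryCategory.{w} C) {X I Y : C} [Injective I]
    (i : X ⟶ I) [Mono i] (e : Ext.{w} Y (cokernel i) 1) : e = 0 := by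
  obtain ⟨x, rfl⟩ := Ext.covariant_sequence_exact₃ Y (shortExact_cokernel i) e (n₁ := 2) rfl
    ((hC 2 (by omega) _ _).elim _ _)
  rw [Ext.eq_zero_of_injective x, Ext.zero_comp]

/-- An object without nonzero morphisms from `P` has a universal extension by an object of `P`,
and the middle term of this extension is right Ext-orthogonal to `P`. -/
lemma exists_shortExact_rightPerp [EnoughProjectives C] [EnoughInjectives C]
    [P.IsClosedUnderExtensions]
    [P.IsClosedUnderKernels] [P.IsClosedUnderCokernels] (hC : IsHereditaryCategory.{w} C)
    (hR : ∀ M : C, ∃ (R : C) (ε : R ⟶ M), IsCoreflection P ε) {K : C}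
    (hK : ∀ Y, P Y → ∀ f : Y ⟶ K, f = 0) :
    ∃ (Z Y : C) (a : K ⟶ Z) (b : Z ⟶ Y) (z : a ≫ b = 0),
      rightPerp.{w} P Z ∧ P Y ∧ (ShortComplex.mk a b z).ShortExact := by
  let i := Injective.ι K
  let p := cokernel.π i
  have hS : (ShortComplex.mk i p (cokernel.condition i)).ShortExact := shortExact_cokernel i
  obtain ⟨R₀, ε₀, hε₀⟩ := hR (Injective.under K)
  obtain ⟨R₁, ε₁, hε₁⟩ := hR (cokernel i)
  have hR₀ : ∀ Y, P Y → ∀ e : Ext.{w} Y R₀ 1, e = 0 := fun Y hY e =>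
    hε₀.ext_eq_zero hY e (Ext.eq_zero_of_injective _)
  have hR₁ : ∀ Y, P Y → ∀ e : Ext.{w} Y R₁ 1, e = 0 := fun Y hY e =>
    hε₁.ext_eq_zero hY e (ext_cokernel_eq_zero hC _ _)
  obtain ⟨φ, hφ⟩ := hε₁.exists_fac _ hε₀.prop (ε₀ ≫ p)
  have : Mono φ := by
    refine Preadditive.mono_of_kernel_zero
      (hε₀.eq_zero _ (P.prop_kernel φ hε₀.prop hε₁.prop) _ ?_)
    have h : (kernel.ι φ ≫ ε₀) ≫ p = 0 := by
      rw [Category.assoc, ← hφ, kernel.condition_assoc, zero_comp]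
    have h' : hS.exact.lift _ h ≫ i = kernel.ι φ ≫ ε₀ := hS.exact.lift_f _ h
    rw [← h', hK _ (P.prop_kernel φ hε₀.prop hε₁.prop) (hS.exact.lift _ h), zero_comp]
  have hY : P (cokernel φ) := P.prop_cokernel φ hε₀.prop hε₁.prop
  -- Here R₁ = R₀ ⊕ coker φ, with `r` the inclusion of coker φ, and the universal extension is the
  -- pullback along `r ≫ ε₁`.
  obtain ⟨σ, hσ⟩ : ∃ σ : R₁ ⟶ R₀, φ ≫ σ = 𝟙 _ :=
    exists_retraction_of_extClass_eq_zero.{w} (shortExact_cokernel φ) (hR₀ _ hY _)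
  obtain ⟨r, hr⟩ : ∃ r, cokernel.π φ ≫ r = 𝟙 R₁ - σ ≫ φ :=
    ⟨cokernel.desc φ (𝟙 R₁ - σ ≫ φ) (by simp [reassoc_of% hσ]), cokernel.π_desc _ _ _⟩
  have hkr : r ≫ cokernel.π φ = 𝟙 _ := by
    rw [← cancel_epi (cokernel.π φ)]; simp [reassoc_of% hr]
  have hσr : r ≫ σ = 0 := by
    rw [← cancel_epi (cokernel.π φ)]; simp [reassoc_of% hr, hσ]
  refine ⟨_, _, _, _, _, ?_, hY, shortExact_pullback hS (r ≫ ε₁)⟩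
  intro Y hPY
  refine extVanishes_of_isHereditary hC (fun f => ?_) (fun e => ?_)
  · obtain ⟨u, hu⟩ := hε₀.exists_fac Y hPY (f ≫ pullback.fst _ _)
    have h := hε₁.eq_zero Y hPY (u ≫ φ - (f ≫ pullback.snd _ _) ≫ r) (by
      rw [Preadditive.sub_comp, Category.assoc, hφ, ← Category.assoc, hu, sub_eq_zero]
      simp only [Category.assoc]
      exact congrArg (fun x => f ≫ x) (pullback.condition (f := p) (g := r ≫ ε₁)))
    rw [sub_eq_zero] at h
    have hv : f ≫ pullback.snd p (r ≫ ε₁) = 0 := by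
      have := congrArg (fun x => x ≫ cokernel.π φ) h
      simpa [hkr] using this.symm
    have hu0 : u = 0 := by
      have := congrArg (fun x => x ≫ σ) h
      simpa [hσ, hσr] using this
    refine pullback.hom_ext ?_ ?_
    · rw [zero_comp]; exact hu.symm.trans (by rw [hu0, zero_comp])
    · rw [zero_comp]; exact hv
  · have hU := shortExact_pullback hS (r ≫ ε₁)
    obtain ⟨e, rfl⟩ := Ext.covariant_sequence_exact₂ Y hU e
      (ext_eq_zero_of_retract_right ⟨r, cokernel.π φ, hkr⟩ (hR₁ Y hPY) _)
    obtain ⟨h, rfl⟩ := Ext.covariant_sequence_exact₁ Y hS e (Ext.eq_zero_of_injective _)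
      (n₀ := 0) rfl
    obtain ⟨h, rfl⟩ := Ext.addEquiv₀.symm.surjective h
    obtain ⟨g, rfl⟩ := hε₁.exists_fac Y hPY h
    have hg : g ≫ ε₁ = (g ≫ σ ≫ ε₀) ≫ p + (g ≫ cokernel.π φ) ≫ (r ≫ ε₁) := by
      have : g ≫ (cokernel.π φ ≫ r + σ ≫ φ) = g := by rw [hr]; simp
      conv_lhs => rw [← this]
      simp only [Preadditive.add_comp, Preadditive.comp_add, Category.assoc, hφ]
      rw [add_comm]
    change ((Ext.mk₀ (g ≫ ε₁)).comp hS.extClass _).comp (Ext.mk₀ _) _ = 0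
    rw [hg, Ext.mk₀_add, Ext.add_comp]
    have h₁ : (Ext.mk₀ ((g ≫ σ ≫ ε₀) ≫ p)).comp hS.extClass (zero_add 1) = 0 := by
      rw [← Ext.mk₀_comp_mk₀, Ext.comp_assoc_of_second_deg_zero]
      erw [hS.comp_extClass]
      rw [Ext.comp_zero]
    have h₂ : (Ext.mk₀ ((g ≫ cokernel.π φ) ≫ (r ≫ ε₁))).comp hS.extClass (zero_add 1) =
        (Ext.mk₀ (g ≫ cokernel.π φ)).comp hU.extClass (zero_add 1) := by
      rw [← extClass_pullback hS (r ≫ ε₁), ← Ext.mk₀_comp_mk₀,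
        Ext.comp_assoc_of_second_deg_zero]
    rw [h₁, zero_add, h₂, Ext.comp_assoc_of_third_deg_zero]
    erw [hU.extClass_comp]
    rw [Ext.comp_zero]

lemma hasApproximationSequence_rightPerp [EnoughProjectives C] [EnoughInjectives C]
    [P.IsClosedUnderExtensions]
    [P.IsClosedUnderKernels] [P.IsClosedUnderCokernels] (hC : IsHereditaryCategory.{w} C)
    (hR : ∀ M : C, ∃ (R : C) (ε : R ⟶ M), IsCoreflection P ε) (M : C) :
    HasApproximationSequence P (rightPerp.{w} P) M := by
  obtain ⟨R, ε, hε⟩ := hR M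
  obtain ⟨Z, Y, a, b, z, hZ, hY, hS⟩ :=
    exists_shortExact_rightPerp hC hR (fun _ hY f => hε.cokernel_hom_eq_zero hC hY f)
  have := hS.mono_f
  have := hS.epi_g
  dsimp at *
  refine ⟨kernel ε, R, Z, Y, kernel.ι ε, ε, cokernel.π ε ≫ a, b, kernel.condition ε,
    by simp, by rw [Category.assoc, z, comp_zero], hε.rightPerp_kernel hC, hε.prop, hZ, hY,
    inferInstance, ShortComplex.exact_kernel ε, ?_, ?_, hS.epi_g⟩
  · exact (ShortComplex.exact_iff_of_epi_of_isIso_of_mono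
      (S₁ := ShortComplex.mk ε (cokernel.π ε) _) (S₂ := ShortComplex.mk ε (cokernel.π ε ≫ a) _)
      { τ₁ := 𝟙 _, τ₂ := 𝟙 _, τ₃ := a }).1 (ShortComplex.exact_cokernel ε)
  · exact (ShortComplex.exact_iff_of_epi_of_isIso_of_mono
      (S₁ := ShortComplex.mk (cokernel.π ε ≫ a) b _) (S₂ := ShortComplex.mk a b z)
      { τ₁ := cokernel.π ε, τ₂ := 𝟙 _, τ₃ := 𝟙 _ }).2 hS.exact

/-- If every object has an approximation sequence, then `P` is the left orthogonal of `P⊥`. -/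
lemma isCompleteExtOrthogonalPair_rightPerp [P.IsClosedUnderIsomorphisms]
    (h : ∀ M : C, HasApproximationSequence P (rightPerp.{w} P) M) :
    IsCompleteExtOrthogonalPair.{w} P (rightPerp.{w} P) where
  rightPerp_eq := rfl
  eq_leftPerp := by
    ext N
    refine ⟨fun hN X hX => hX N hN, fun hN => ?_⟩
    obtain ⟨Z₁, Y₁, Z₂, Y₂, a, b, c, d, hab, hbc, hcd, hZ₁, hY₁, hZ₂, hY₂, ha, e₁, e₂, e₃, hd⟩ :=
      h N
    have hc : c = 0 := hom_eq_zero_of_extVanishes (hN _ hZ₂) c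
    have : Epi b := e₂.epi_f hc
    have hS : (ShortComplex.mk a b hab).ShortExact := { exact := e₁ }
    obtain ⟨s, hs⟩ := exists_retraction_of_extClass_eq_zero.{w} hS ((hN _ hZ₁ 1).elim _ _)
    have hs0 : s = 0 := hom_eq_zero_of_extVanishes (hZ₁ _ hY₁) s
    have ha0 : a = 0 := by
      rw [← Category.id_comp a]
      change 𝟙 Z₁ ≫ a = 0
      rw [← hs, hs0, comp_zero, zero_comp]
    have : Mono b := e₁.mono_g ha0
    have : IsIso b := isIso_of_mono_of_epi b
    exact P.prop_of_iso (asIso b) hY₁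
  exists_sequence := h

end

/-! ### Relative epimorphisms and a bound on their targets -/

section

open Limits

/-- The closure properties of a subcategory of a module category that make it bireflective. -/
class IsBireflective {R : Type u} [Ring R] (P : ObjectProperty (ModuleCat.{u} R)) : Prop where
  isClosedUnderIsomorphisms : P.IsClosedUnderIsomorphisms
  isClosedUnderKernels : P.IsClosedUnderKernels
  isClosedUnderCokernels : P.IsClosedUnderCokernels
  isClosedUnderProducts : IsClosedUnderProducts P
  isClosedUnderCoproducts : IsClosedUnderCoproducts P

attribute [instance] IsBireflective.isClosedUnderIsomorphisms
  IsBireflective.isClosedUnderKernels IsBireflective.isClosedUnderCokernels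

variable {R : Type u} [Ring R] {P : ObjectProperty (ModuleCat.{u} R)}

namespace IsBireflective

variable [IsBireflective P] {M N Q : Type u} [AddCommGroup M] [Module R M] [AddCommGroup N]
  [Module R N] [AddCommGroup Q] [Module R Q]

lemma prop_of_equiv (e : M ≃ₗ[R] N) (hM : P (.of R M)) : P (.of R N) :=
  P.prop_of_iso e.toModuleIso hM

lemma prop_of_exact_of_injective (f : M →ₗ[R] N) (g : N →ₗ[R] Q) (h : Function.Exact f g)
    (hf : Function.Injective f) (hN : P (.of R N)) (hQ : P (.of R Q)) : P (.of R M) :=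
  P.prop_of_isLimit_kernelFork
    (ModuleCat.isLimitKernelFork (ModuleCat.ofHom f) (ModuleCat.ofHom g) h hf) hN hQ

lemma prop_of_exact_of_surjective (f : M →ₗ[R] N) (g : N →ₗ[R] Q) (h : Function.Exact f g)
    (hg : Function.Surjective g) (hM : P (.of R M)) (hN : P (.of R N)) : P (.of R Q) :=
  P.prop_of_isColimit_cokernelCofork
    (ModuleCat.isColimitCokernelCofork (ModuleCat.ofHom f) (ModuleCat.ofHom g) h hg) hM hN

lemma prop_ker (f : M →ₗ[R] N) (hM : P (.of R M)) (hN : P (.of R N)) :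
    P (.of R (LinearMap.ker f)) :=
  prop_of_exact_of_injective _ f (LinearMap.exact_subtype_ker_map f)
    (Submodule.injective_subtype _) hM hN

lemma prop_quotient (S : Submodule R M) (hM : P (.of R M)) (hS : P (.of R S)) :
    P (.of R (M ⧸ S)) :=
  prop_of_exact_of_surjective S.subtype S.mkQ (LinearMap.exact_subtype_mkQ S)
    S.mkQ_surjective hS hM

lemma prop_range (f : M →ₗ[R] N) (hM : P (.of R M)) (hN : P (.of R N)) :
    P (.of R (LinearMap.range f)) :=
  prop_of_equiv f.quotKerEquivRange (prop_quotient _ hM (prop_ker f hM hN))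

lemma prop_pi {ι : Type u} (Z : ι → Type u) [∀ i, AddCommGroup (Z i)] [∀ i, Module R (Z i)]
    (h : ∀ i, P (.of R (Z i))) : P (.of R (∀ i, Z i)) := by
  have := isClosedUnderProducts (P := P) ι
  exact P.prop_of_isLimit (ModuleCat.productConeIsLimit.{u, u} fun i => ModuleCat.of R (Z i))
    fun i => h i.as

lemma prop_prod (hM : P (.of R M)) (hN : P (.of R N)) : P (.of R (M × N)) := by
  have := isClosedUnderProducts (P := P) (ULift.{u} WalkingPair)
  have := ObjectProperty.IsClosedUnderLimitsOfShape.of_equivalence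
    (P := P) (Discrete.equivalence (Equiv.ulift : ULift.{u} WalkingPair ≃ WalkingPair))
  exact P.prop_of_isLimit (ModuleCat.binaryProductLimitCone (.of R M) (.of R N)).isLimit
    (by rintro ⟨_ | _⟩ <;> assumption)

open DirectSum in
lemma prop_directSum {ι : Type u} (Z : ι → Type u) [∀ i, AddCommGroup (Z i)]
    [∀ i, Module R (Z i)] (h : ∀ i, P (.of R (Z i))) : P (.of R (⨁ i, Z i)) := by
  classical
  have := isClosedUnderCoproducts (P := P) ι
  exact P.prop_of_isColimit
    (ModuleCat.coproductCoconeIsColimit.{u, u} fun i => ModuleCat.of R (Z i)) fun i => h i.as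

lemma prop_iSup {ι : Type u} (F : ι → Submodule R M) (hM : P (.of R M))
    (h : ∀ i, P (.of R (F i))) : P (.of R (⨆ i, F i : Submodule R M)) := by
  classical
  rw [← DirectSum.range_coeLinearMap]
  exact prop_range _ (prop_directSum _ h) hM

lemma prop_sInf (S : Set (Submodule R M)) (hM : P (.of R M)) (h : ∀ N ∈ S, P (.of R N)) :
    P (.of R (sInf S : Submodule R M)) := by
  have : sInf S = LinearMap.ker (LinearMap.pi fun N : S => N.1.mkQ) := by
    rw [LinearMap.ker_pi, sInf_eq_iInf']
    simp
  rw [this]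
  exact prop_ker _ hM (prop_pi _ fun N => prop_quotient _ hM (h _ N.2))

end IsBireflective

open IsBireflective

/-- `f : M → Y` is an epimorphism relative to `P`. -/
def IsRelEpi (P : ObjectProperty (ModuleCat.{u} R)) {M Y : Type u} [AddCommGroup M] [Module R M]
    [AddCommGroup Y] [Module R Y] (f : M →ₗ[R] Y) : Prop :=
  ∀ Z : ModuleCat.{u} R, P Z → ∀ g : Y →ₗ[R] Z, g ∘ₗ f = 0 → g = 0

variable {M Y : Type u} [AddCommGroup M] [Module R M] [AddCommGroup Y] [Module R Y]

/-- Every map to an object of `P` is relatively epimorphic onto a subobject in `P`. -/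
lemma exists_isRelEpi_codRestrict [IsBireflective P] (hY : P (.of R Y)) (f : M →ₗ[R] Y) :
    ∃ (N : Submodule R Y) (h : ∀ m, f m ∈ N), P (.of R N) ∧ IsRelEpi P (f.codRestrict N h) := by
  let S : Set (Submodule R Y) := {N | P (.of R N) ∧ LinearMap.range f ≤ N}
  have hN : P (.of R (sInf S : Submodule R Y)) := prop_sInf S hY fun N hN => hN.1
  have hf : LinearMap.range f ≤ sInf S := le_sInf fun N hN => hN.2
  refine ⟨sInf S, fun m => hf ⟨m, rfl⟩, hN, fun Z hZ g hg => ?_⟩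
  -- The kernel of `g` is a subobject in `P` through which `f` factors, so by minimality it is
  -- everything.
  have hmem : (LinearMap.ker g).map (sInf S).subtype ∈ S := by
    refine ⟨prop_of_equiv ((LinearMap.ker g).equivMapOfInjective _
      (Submodule.injective_subtype _)) (prop_ker g hN hZ), ?_⟩
    rintro _ ⟨m, rfl⟩
    exact ⟨⟨f m, hf ⟨m, rfl⟩⟩, LinearMap.congr_fun hg m, rfl⟩
  ext x
  obtain ⟨y, hy, hyx⟩ := sInf_le hmem x.2
  obtain rfl : y = x := Subtype.ext hyx
  exact hy

/-- Elements of the target of a relative epimorphism are determined by finitely many linear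
relations. -/
lemma IsRelEpi.exists_finite_witness [IsBireflective P] {f : M →ₗ[R] Y} (hf : IsRelEpi P f)
    (z : Y) :
    ∃ (n : ℕ) (α : (Fin n → R) →ₗ[R] Y) (e : Fin n → R), α e = z ∧
      ∀ Z : ModuleCat.{u} R, P Z → ∀ β : (Fin n → R) →ₗ[R] Z,
        (LinearMap.range f).comap α ≤ LinearMap.ker β → β e = 0 := by
  classical
  by_contra! H
  -- Compactness: without a witness, each finite `G` admits a function on Y that respects all
  -- relations modulo im f supported in `G`, yet is nonzero at `z`.
  have key : ∀ G : Finset Y, ∃ (Z : ModuleCat.{u} R) (b : Y → Z), P Z ∧ b z ≠ 0 ∧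
      ∀ r : Y →₀ R, r.support ⊆ G → Finsupp.linearCombination R id r ∈ LinearMap.range f →
        Finsupp.linearCombination R b r = 0 := by
    intro G
    let G' := insert z G
    let ε : Fin G'.card ≃ G' := G'.equivFin.symm
    have hz : z ∈ G' := Finset.mem_insert_self _ _
    obtain ⟨Z, hZ, β, hβ, hne⟩ := H G'.card
      (Fintype.linearCombination R fun i => (ε i : Y)) (Pi.single (ε.symm ⟨z, hz⟩) 1) (by
        simp)
    let b : Y → Z := fun y => if h : y ∈ G' then β (Pi.single (ε.symm ⟨y, h⟩) 1) else 0
    refine ⟨Z, b, hZ, by simpa [b, hz] using hne, fun r hr hrf => ?_⟩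
    have h₁ : ∀ y : G', ∑ i, (Pi.single (ε.symm y) (1 : R) : Fin G'.card → R) i • (ε i : Y) = y := by
      intro y
      simp [Pi.single_apply, ite_smul]
    have hr' : r.support ⊆ G' := hr.trans (Finset.subset_insert _ _)
    let s : Fin G'.card → R := ∑ y : G', r y • Pi.single (ε.symm y) 1
    have hs : Fintype.linearCombination R (fun i => (ε i : Y)) s =
        Finsupp.linearCombination R id r := by
      rw [Finsupp.linearCombination_apply, Finsupp.sum_of_support_subset r hr' _ (by simp),
        ← Finset.sum_coe_sort G']
      simp only [s, map_sum, map_smul]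
      refine Finset.sum_congr rfl fun y _ => ?_
      rw [Fintype.linearCombination_apply, h₁]
      rfl
    have hb : β s = Finsupp.linearCombination R b r := by
      rw [Finsupp.linearCombination_apply, Finsupp.sum_of_support_subset r hr' _ (by simp),
        ← Finset.sum_coe_sort G']
      simp only [s, map_sum, map_smul]
      refine Finset.sum_congr rfl fun y _ => ?_
      simp [b]
    rw [← hb]
    exact hβ (by rw [Submodule.mem_comap, hs]; exact hrf)
  choose Z b hZ hbz hb using key
  -- Families vanishing at every G ⊇ G₀. Their directed union `E` lies in `P` by closure under
  -- kernels and sums, hence so does the reduced product by `E`.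
  let F : Finset Y → Submodule R (∀ G, Z G) := fun G₀ =>
    LinearMap.ker (LinearMap.pi fun G : {G // G₀ ⊆ G} =>
      LinearMap.proj (R := R) (φ := fun G => Z G) G.1)
  have hF : ∀ {G₀ w}, w ∈ F G₀ ↔ ∀ G, G₀ ⊆ G → w G = 0 := by
    intro G₀ w
    simp [F, LinearMap.mem_ker, funext_iff]
  have hdir : Directed (· ≤ ·) F := fun G₁ G₂ => ⟨G₁ ∪ G₂,
    fun w hw => hF.2 fun G hG => hF.1 hw G (Finset.union_subset_left hG),
    fun w hw => hF.2 fun G hG => hF.1 hw G (Finset.union_subset_right hG)⟩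
  let E := ⨆ G, F G
  have hE : ∀ {w}, w ∈ E ↔ ∃ G₀, ∀ G, G₀ ⊆ G → w G = 0 := by
    intro w
    rw [Submodule.mem_iSup_of_directed _ hdir]
    simp only [hF]
  have hPZ : P (.of R (∀ G, Z G)) := prop_pi _ hZ
  have hPQ : P (.of R ((∀ G, Z G) ⧸ E)) := prop_quotient _ hPZ
    (prop_iSup _ hPZ fun G => prop_ker _ hPZ (prop_pi _ fun G => hZ _))
  have hrel : ∀ r : Y →₀ R, Finsupp.linearCombination R id r ∈ LinearMap.range f →
      (fun G => Finsupp.linearCombination R (b G) r) ∈ E := fun r hr =>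
    hE.2 ⟨r.support, fun G hG => hb G r hG hr⟩
  -- Every relation has finite support, so it holds for all large G; the functions `b G` thus become
  -- linear in the quotient.
  let g : Y →ₗ[R] (∀ G, Z G) ⧸ E :=
    { toFun := fun y => E.mkQ fun G => b G y
      map_add' := fun x y => by
        rw [← map_add, ← sub_eq_zero, ← map_sub, Submodule.mkQ_apply, Submodule.Quotient.mk_eq_zero]
        convert hrel (Finsupp.single (x + y) 1 - (Finsupp.single x 1 + Finsupp.single y 1)) (by simp)
          using 1
        funext G
        simp
      map_smul' := fun c y => by
        rw [← map_smul, ← sub_eq_zero, ← map_sub, Submodule.mkQ_apply, Submodule.Quotient.mk_eq_zero]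
        convert hrel (Finsupp.single (c • y) 1 - Finsupp.single y c) (by simp) using 1
        funext G
        simp }
  have hg : g = 0 := hf (.of R _) hPQ g (by
    ext m
    change E.mkQ _ = 0
    rw [Submodule.mkQ_apply, Submodule.Quotient.mk_eq_zero]
    convert hrel (Finsupp.single (f m) 1) (by simp) using 1
    funext G
    simp)
  have hgz : E.mkQ (fun G => b G z) = 0 := LinearMap.congr_fun hg z
  rw [Submodule.mkQ_apply, Submodule.Quotient.mk_eq_zero, hE] at hgz
  obtain ⟨G, hG⟩ := hgz
  exact hbz G (hG G subset_rfl)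

variable (R) in
/-- A set bounding the size of targets of relative epimorphisms out of `M`. -/
abbrev RelEpiBound (M : Type u) : Type u :=
  Σ n : ℕ, (Fin n → R) × Set ((Fin n → R) × M)

lemma IsRelEpi.exists_injective [IsBireflective P] (hY : P (.of R Y)) {f : M →ₗ[R] Y}
    (hf : IsRelEpi P f) : ∃ φ : Y → RelEpiBound R M, Function.Injective φ := by
  choose n α e he hw using hf.exists_finite_witness
  -- If two elements share this code, the difference of their maps `α` kills every relation modulo
  -- im f, so by the witness property it kills `e`.
  refine ⟨fun z => ⟨n z, e z, {x | α z x.1 = f x.2}⟩, fun z z' h => ?_⟩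
  suffices ∀ (n n' : ℕ) (α : (Fin n → R) →ₗ[R] Y) (α' : (Fin n' → R) →ₗ[R] Y)
      (e : Fin n → R) (e' : Fin n' → R)
      (_ : ∀ Z : ModuleCat.{u} R, P Z → ∀ β : (Fin n → R) →ₗ[R] Z,
        (LinearMap.range f).comap α ≤ LinearMap.ker β → β e = 0)
      (_ : (⟨n, e, {x | α x.1 = f x.2}⟩ : RelEpiBound R M) = ⟨n', e', {x | α' x.1 = f x.2}⟩),
      α e = α' e' by
    rw [← he z, ← he z']
    exact this _ _ _ _ _ _ (hw z) h
  intro n n' α α' e e' hα h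
  obtain rfl : n = n' := congrArg Sigma.fst h
  obtain ⟨rfl, hS⟩ := Prod.mk.inj (eq_of_heq (Sigma.mk.inj h).2)
  have := hα (.of R Y) hY (α - α') (by
    rintro r ⟨m, hm⟩
    have h₁ : (r, m) ∈ {x : (Fin n → R) × M | α x.1 = f x.2} := hm.symm
    rw [hS] at h₁
    rw [LinearMap.mem_ker, LinearMap.sub_apply, ← hm, ← show α' r = f m from h₁, sub_self])
  exact sub_eq_zero.1 this

end

/-! ### Existence of reflections and coreflections -/

section

open Limits IsBireflective

variable {R : Type u} [Ring R] {P : ObjectProperty (ModuleCat.{u} R)}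

/-- Every map to `P` factors through the product of the `Z i`; cutting down to the smallest
subobject in `P` containing the image makes factorizations unique. -/
lemma exists_isReflection_of_solutionSet [IsBireflective P] {M : ModuleCat.{u} R} {I : Type u}
    (Z : I → ModuleCat.{u} R) (hZ : ∀ i, P (Z i)) (f : ∀ i, M →ₗ[R] Z i)
    (h : ∀ Y : ModuleCat.{u} R, P Y → ∀ g : M →ₗ[R] Y, ∃ (i : I) (k : Z i →ₗ[R] Y),
      k ∘ₗ f i = g) :
    ∃ (L : ModuleCat.{u} R) (η : M ⟶ L), IsReflection P η := by
  obtain ⟨L, hfL, hL, hη⟩ := exists_isRelEpi_codRestrict (prop_pi (fun i => Z i) hZ)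
    (LinearMap.pi f)
  refine ⟨.of R L, ModuleCat.ofHom ((LinearMap.pi f).codRestrict L hfL), hL, fun Y hY g => ?_,
    fun Y hY g hg => ModuleCat.hom_ext (hη Y hY g.hom (congrArg ModuleCat.Hom.hom hg))⟩
  obtain ⟨i, k, hk⟩ := h Y hY g.hom
  exact ⟨ModuleCat.ofHom (k ∘ₗ LinearMap.proj i ∘ₗ L.subtype), ModuleCat.hom_ext hk⟩

lemma exists_isReflection [IsBireflective P] (M : ModuleCat.{u} R) :
    ∃ (L : ModuleCat.{u} R) (η : M ⟶ L), IsReflection P η := by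
  let T := RelEpiBound R M
  refine exists_isReflection_of_solutionSet
    -- A target that embeds as a set in `T` is a quotient of the free module on `T`, so these
    -- quotients form a small solution set.
    (I := {x : Σ N : Submodule R (T →₀ R), M →ₗ[R] (T →₀ R) ⧸ N //
      P (.of R ((T →₀ R) ⧸ x.1))})
    (fun i => .of R ((T →₀ R) ⧸ i.1.1)) (fun i => i.2) (fun i => i.1.2) fun Y hY g => ?_
  obtain ⟨N, hgN, hN, hrel⟩ := exists_isRelEpi_codRestrict (Y := Y) hY g
  obtain ⟨φ, hφ⟩ := hrel.exists_injective hN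
  let π : (T →₀ R) →ₗ[R] N := Finsupp.linearCombination R (Function.invFun φ)
  have hπ : Function.Surjective π := fun y =>
    ⟨Finsupp.single (φ y) 1, by simp [π, Function.leftInverse_invFun hφ y]⟩
  let e := π.quotKerEquivOfSurjective hπ
  refine ⟨⟨⟨LinearMap.ker π, e.symm.toLinearMap ∘ₗ g.codRestrict N hgN⟩,
    prop_of_equiv e.symm hN⟩, N.subtype ∘ₗ e.toLinearMap, ?_⟩
  ext m
  change (e (e.symm (g.codRestrict N hgN m)) : Y) = g m
  rw [LinearEquiv.apply_symm_apply]
  rfl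

/-- The reflection of the free module of rank one generates `P`. -/
lemma exists_generator [IsBireflective P] :
    ∃ B : ModuleCat.{u} R, P B ∧ ∀ Y : ModuleCat.{u} R, P Y → ∀ y : Y,
      ∃ (f : B →ₗ[R] Y) (b : B), f b = y := by
  obtain ⟨B, η, hη⟩ := exists_isReflection (P := P) (.of R R)
  refine ⟨B, hη.prop, fun Y hY y => ?_⟩
  obtain ⟨g, hg⟩ := hη.exists_fac Y hY (ModuleCat.ofHom (LinearMap.toSpanSingleton R Y y))
  refine ⟨g.hom, η.hom (1 : R), ?_⟩
  have := LinearMap.congr_fun (congrArg ModuleCat.Hom.hom hg) (1 : R)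
  exact this.trans (by simp)

open DirectSum in
-- The coproduct of copies of a generator B over all maps B → M receives every such map. Dividing by
-- the images of all maps from B killed by `ε` makes factorizations unique.
lemma exists_isCoreflection [IsBireflective P] (M : ModuleCat.{u} R) :
    ∃ (L : ModuleCat.{u} R) (ε : L ⟶ M), IsCoreflection P ε := by
  classical
  obtain ⟨B, hB, hgen⟩ := exists_generator (P := P)
  let D := ⨁ _ : (B →ₗ[R] M), B
  have hD : P (.of R D) := prop_directSum _ fun _ => hB
  let ε : D →ₗ[R] M := DirectSum.toModule R _ _ fun h => h
  have hε : ∀ h b, ε (DirectSum.lof R (B →ₗ[R] M) (fun _ => B) h b) = h b := fun h b =>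
    DirectSum.toModule_lof _ _ _
  let N : Submodule R D := ⨆ k : {k : B →ₗ[R] D // ε ∘ₗ k = 0}, LinearMap.range k.1
  have hN : P (.of R N) := prop_iSup _ hD fun k => prop_range _ hB hD
  have hNε : N ≤ LinearMap.ker ε := iSup_le fun k => by
    rintro _ ⟨b, rfl⟩
    exact LinearMap.congr_fun k.2 b
  have hmem : ∀ k : B →ₗ[R] D, ε ∘ₗ k = 0 → ∀ b, k b ∈ N := fun k hk b =>
    le_iSup (fun k : {k : B →ₗ[R] D // ε ∘ₗ k = 0} => LinearMap.range k.1) ⟨k, hk⟩ ⟨b, rfl⟩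
  have hL : P (.of R (D ⧸ N)) := prop_quotient _ hD hN
  refine ⟨.of R (D ⧸ N), ModuleCat.ofHom (N.liftQ ε hNε), hL, fun Y hY g => ?_,
    fun Y hY d hd => ?_⟩
  · let F := ⨁ _ : (B →ₗ[R] Y), B
    have hF : P (.of R F) := prop_directSum _ fun _ => hB
    let s : F →ₗ[R] Y := DirectSum.toModule R _ _ fun h => h
    let t : F →ₗ[R] D := DirectSum.toModule R _ _ fun h => 
      DirectSum.lof R (B →ₗ[R] M) (fun _ => B) (g.hom ∘ₗ h)
    have hs : Function.Surjective s := fun y => by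
      obtain ⟨h, b, rfl⟩ := hgen Y hY y
      exact ⟨DirectSum.lof R _ _ h b, DirectSum.toModule_lof _ _ _⟩
    have hεt : ε ∘ₗ t = g.hom ∘ₗ s := by
      refine DirectSum.linearMap_ext _ fun h => ?_
      ext b
      simp only [t, s, LinearMap.comp_apply, DirectSum.toModule_lof]
      exact hε _ _
    -- As ker s lies in `P`, each of its elements is hit by a map from B; followed by `t`, that map
    -- is killed by `ε`, so it lands in `N`.
    have hker : LinearMap.ker s ≤ LinearMap.ker (N.mkQ ∘ₗ t) := fun x hx => by
      obtain ⟨h, b, hb⟩ := hgen (.of R (LinearMap.ker s)) (prop_ker s hF hY) ⟨x, hx⟩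
      have h₁ := hmem (t ∘ₗ (LinearMap.ker s).subtype ∘ₗ h) (by
        ext b
        have := LinearMap.congr_fun hεt ((LinearMap.ker s).subtype (h b))
        refine this.trans ?_
        change g.hom (s (h b).1) = 0
        rw [(h b).2, map_zero]) b
      have h₂ : t x ∈ N := by
        have : (LinearMap.ker s).subtype (h b) = x := congrArg Subtype.val hb
        rw [← this]
        exact h₁
      rw [LinearMap.mem_ker, LinearMap.comp_apply, Submodule.mkQ_apply,
        Submodule.Quotient.mk_eq_zero]
      exact h₂
    refine ⟨ModuleCat.ofHom ((LinearMap.ker s).liftQ _ hker ∘ₗ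
      (s.quotKerEquivOfSurjective hs).symm.toLinearMap), ?_⟩
    ext y
    obtain ⟨x, rfl⟩ := hs y
    have : (s.quotKerEquivOfSurjective hs).symm (s x) = (LinearMap.ker s).mkQ x := by
      rw [LinearEquiv.symm_apply_eq]
      rfl
    change N.liftQ ε hNε ((LinearMap.ker s).liftQ _ hker
      ((s.quotKerEquivOfSurjective hs).symm (s x))) = g.hom (s x)
    rw [this]
    exact LinearMap.congr_fun hεt x
  · ext y
    obtain ⟨p, hp⟩ := N.mkQ_surjective (d.hom y)
    -- The pullback of D → D/N along `d` lies in `P`, so the pair (p, y) is hit by a map from B; its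
    -- component in D is killed by `ε`.
    let V := LinearMap.ker (N.mkQ.coprod (-d.hom))
    have hV : P (.of R V) := prop_ker _ (prop_prod hD hY) hL
    obtain ⟨h, b, hb⟩ := hgen (.of R V) hV ⟨(p, y), by
      rw [LinearMap.mem_ker, LinearMap.coprod_apply, hp, LinearMap.neg_apply, add_neg_cancel]⟩
    have h₁ := hmem (LinearMap.fst R D Y ∘ₗ V.subtype ∘ₗ h) (by
      ext b
      have hq : N.mkQ (h b).1.1 = d.hom (h b).1.2 := by
        have := LinearMap.mem_ker.1 (h b).2
        rwa [LinearMap.coprod_apply, LinearMap.neg_apply, ← sub_eq_add_neg, sub_eq_zero] at this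
      have h₂ := LinearMap.congr_fun (congrArg ModuleCat.Hom.hom hd) (h b).1.2
      change N.liftQ ε hNε (d.hom (h b).1.2) = 0 at h₂
      rw [← hq] at h₂
      exact h₂) b
    have h₂ : p ∈ N := by
      have : (h b).1.1 = p := congrArg (fun v : V => v.1.1) hb
      rw [← this]
      exact h₁
    rw [← hp, Submodule.mkQ_apply, (Submodule.Quotient.mk_eq_zero N).2 h₂]
    rfl

end

/-! ### Abelian subcategories are closed under kernels and cokernels -/

section

open Limits

variable {C : Type u} [Category.{v} C] [Abelian C] {P : ObjectProperty C}

lemma IsAbelianSubcategory.isClosedUnderKernels (h : IsAbelianSubcategory P) :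
    P.IsClosedUnderKernels where
  kernels_le := by
    rintro _ ⟨f, k, hk, hX, hY⟩
    have := h.closedUnderIso
    obtain ⟨_⟩ := h.abelian
    have : PreservesFiniteLimits P.ι := h.exact_ι.1
    let f' : (⟨_, hX⟩ : P.FullSubcategory) ⟶ (⟨_, hY⟩ : P.FullSubcategory) := ObjectProperty.homMk f
    -- The equalizer with the ambient zero map avoids comparing it with the zero of the given
    -- abelian structure on the subcategory.
    let z' : (⟨_, hX⟩ : P.FullSubcategory) ⟶ (⟨_, hY⟩ : P.FullSubcategory) := ObjectProperty.homMk 0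
    have hl : IsLimit (Fork.ofι (f := f) (g := 0) (P.ι.map (equalizer.ι f' z')) _) :=
      isLimitForkMapOfIsLimit P.ι _ (equalizerIsEqualizer f' z')
    exact P.prop_of_iso (hl.conePointUniqueUpToIso hk) (equalizer f' z').property

lemma IsAbelianSubcategory.isClosedUnderCokernels (h : IsAbelianSubcategory P) :
    P.IsClosedUnderCokernels where
  cokernels_le := by
    rintro _ ⟨f, k, hk, hX, hY⟩
    have := h.closedUnderIso
    obtain ⟨_⟩ := h.abelian
    have : PreservesFiniteColimits P.ι := h.exact_ι.2
    let f' : (⟨_, hX⟩ : P.FullSubcategory) ⟶ (⟨_, hY⟩ : P.FullSubcategory) := ObjectProperty.homMk f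
    let z' : (⟨_, hX⟩ : P.FullSubcategory) ⟶ (⟨_, hY⟩ : P.FullSubcategory) := ObjectProperty.homMk 0
    have hl : IsColimit (Cofork.ofπ (f := f) (g := 0) (P.ι.map (coequalizer.π f' z')) _) :=
      isColimitCoforkMapOfIsColimit P.ι _ (coequalizerIsCoequalizer f' z')
    exact P.prop_of_iso (hl.coconePointUniqueUpToIso hk) (coequalizer f' z').property

end

end ExtOrthogonal

theorem corollary3p4 (A : Type u) [Ring A] (hA : ExtOrthogonal.IsHereditaryRing A)
    (𝒴 : ObjectProperty (ExtOrthogonal.RightMod A))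
    (hab : ExtOrthogonal.IsAbelianSubcategory 𝒴)
    (hext : 𝒴.IsClosedUnderExtensions)
    (hprod : ExtOrthogonal.IsClosedUnderProducts 𝒴)
    (hcoprod : ExtOrthogonal.IsClosedUnderCoproducts 𝒴) :
    ExtOrthogonal.IsCompleteExtOrthogonalPair.{u} (ExtOrthogonal.leftPerp.{u} 𝒴) 𝒴 ∧
      ExtOrthogonal.IsCompleteExtOrthogonalPair.{u} 𝒴 (ExtOrthogonal.rightPerp.{u} 𝒴) := by
  have : ExtOrthogonal.IsBireflective 𝒴 :=
    ⟨hab.closedUnderIso, hab.isClosedUnderKernels, hab.isClosedUnderCokernels, hprod, hcoprod⟩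
  exact ⟨ExtOrthogonal.isCompleteExtOrthogonalPair_leftPerp
      (ExtOrthogonal.hasApproximationSequence_leftPerp hA ExtOrthogonal.exists_isReflection),
    ExtOrthogonal.isCompleteExtOrthogonalPair_rightPerp
      (ExtOrthogonal.hasApproximationSequence_rightPerp hA ExtOrthogonal.exists_isCoreflection)⟩
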